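/- Let $(x,y)$ have joint law $P$ on $\mathcal X\times\{+1,-1\}$ (e.g. $\mathcal X=\mathbb R^d$), with class priors $\pi_p=P(y=+1)>0$ and $\pi_n=P(y=-1)>0$, class-conditional laws $p_p,p_n$ of $x$ given $y=+1$, $y=-1$, and marginal law $p=\pi_pp_p+\pi_np_n$ of $x$. Let $(x_i^p)_{i\le n_p}\sim p_p$, $(x_i^n)_{i\le n_n}\sim p_n$, $(x_i^u)_{i\le n_u}\sim p$ be independent i.i.d. samples, with $n_p,n_n,n_u\ge 1$. For a loss $\ell:\mathbb R\times\{+1,-1\}\to\mathbb R$ put $\mathcal R(g)=\mathbb E_{(x,y)\sim P}[\ell(g(x),y)]$, $\mathcal R_p^+(g)=\mathbb E_{x\sim p_p}[\ell(g(x),+1)]$ and, for $k\in\{p,n,u\}$, $\hat{\mathcal R}_k^{\pm}(g)=\frac1{n_k}\sum_{i=1}^{n_k}\ell(g(x_i^k),\pm1)$. For $a\in(0,1)$ let $$\hat{\mathcal R}^1_s(g)=\pi_n\hat{\mathcal R}_n^-(g)+(1-a)\pi_p\hat{\mathcal R}_p^+(g)+a\max\{0,\hat{\mathcal R}_u^+(g)-\pi_n\hat{\mathcal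 R}_n^+(g)\}.$$ Let $\mathcal G$ be a class of measurable functions $g:\mathcal X\to\mathbb R$ with $\sup_x|g(x)|\le C_g$ for all $g\in\mathcal G$ (such that suprema over $g\in\mathcal G$ of continuous functions of finitely many values of $g$ are universally measurable in the points of evaluation), and let $C_\ell>0$ satisfy $0\le\ell(t,y)\le C_\ell$ for all $|t|\le C_g$ and $y\in\{+1,-1\}$. Assume that (i) there is $\rho>0$ with $\mathcal R_p^+(g)\ge\rho$ for all $g\in\mathcal G$; (ii) $g\in\mathcal G$ implies $-g\in\mathcal G$; (iii) $t\mapsto\ell(t,1)$ and $t\mapsto\ell(t,-1)$ are $L_\ell$-Lipschitz on $\{t:|t|\le C_g\}$. Let $g^*\in\mathcal G$ minimize $\mathcal R$ over $\mathcal G$ and let $\hat g^1\in\mathcal G$ minimize $\hat{\mathcal R}^1_s$ over $\mathcal G$. For a law $q$ let $$\mathfrak R_{n,q}(\mathcal G)=\mathbb E_{Z\sim q^n}\mathbb E_\sigma\Big[\sup_{g\in\mathcal G}\frac1n\sum_{i=1}^n\sigma_ig(Z_i)\Big],$$ with $\sigma$ uniform on $\{-1,1\}^n$, and let $\epsilon=a\pi_nC_\ell\exp\Big(-\frac{2\pi_p^2\rho^2}{C_\ell^2(1/n_u+\pi_n^2/n_n)}\Big)$.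 Then for every $\delta>0$, with probability at least $1-\delta$ (simultaneously for all minimizers $\hat g^1$), $$\mathcal R(\hat g^1)-\mathcal R(g^*)\le 8(1+a)\pi_nL_\ell\mathfrak R_{n_n,p_n}(\mathcal G)+8(1-a)\pi_pL_\ell\mathfrak R_{n_p,p_p}(\mathcal G)+8aL_\ell\mathfrak R_{n_u,p}(\mathcal G)+2C_\ell\sqrt{\tfrac{\ln(2/\delta)}2}\Big(\frac{(1+a)\pi_n}{\sqrt{n_n}}+\frac{(1-a)\pi_p}{\sqrt{n_p}}+\frac a{\sqrt{n_u}}\Big)+2\epsilon,$$ a claim that is void for $\delta\ge1$. -/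

import Mathlib

open MeasureTheory ProbabilityTheory
open scoped NNReal

noncomputable section

namespace AnomalyRisk

variable {X : Type*} [MeasurableSpace X]

/-! Labels are the elements of `ℤˣ = {1, -1}`: `1` is the positive (normal) class and `-1` the
negative (anomalous) class. `P` is the joint law of `(x, y)`. -/

/-- The class prior `π_y = P(label = y)`. -/
def classPrior (P : Measure (X × ℤˣ)) (y : ℤˣ) : ℝ :=
  P.real {z | z.2 = y}

/-- The class-conditional law of `x` given that the label is `y`
(`p_p` for `y = 1`, `p_n` for `y = -1`). -/
def classLaw (P : Measure (X × ℤˣ)) (y : ℤˣ) : Measure X :=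
  (ProbabilityTheory.cond P {z | z.2 = y}).map Prod.fst

/-- The law `p` of an unlabeled instance: the first marginal of `P`. -/
def unlabeledLaw (P : Measure (X × ℤˣ)) : Measure X :=
  P.map Prod.fst

/-- The risk `R(g) = E_{(x,y) ∼ P} [ℓ(g(x), y)]`. -/
def risk (ℓ : ℝ → ℤˣ → ℝ) (P : Measure (X × ℤˣ)) (g : X → ℝ) : ℝ :=
  ∫ z, ℓ (g z.1) z.2 ∂P

/-- The risk `E_{x ∼ q} [ℓ(g(x), y)]` with a fixed label `y`; for instance
`R_p^+(g) = lawRisk ℓ p_p 1 g`. -/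
def lawRisk (ℓ : ℝ → ℤˣ → ℝ) (q : Measure X) (y : ℤˣ) (g : X → ℝ) : ℝ :=
  ∫ x, ℓ (g x) y ∂q

/-- The empirical risk `(1/n) ∑ i, ℓ(g(x_i), y)` of a sample, with a fixed label `y`. -/
def empRisk (ℓ : ℝ → ℤˣ → ℝ) (y : ℤˣ) {n : ℕ} (x : Fin n → X) (g : X → ℝ) : ℝ :=
  (1 / (n : ℝ)) * ∑ i, ℓ (g (x i)) y

/-- A data set: the positive, the negative and the unlabeled sample, in this order. -/
abbrev Data (X : Type*) (np nn nu : ℕ) : Type _ :=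
  (Fin np → X) × (Fin nn → X) × (Fin nu → X)

/-- The law of a data set whose three samples are independent and i.i.d. from
`p_p`, `p_n` and `p` respectively. -/
def dataLaw (P : Measure (X × ℤˣ)) (np nn nu : ℕ) : Measure (Data X np nn nu) :=
  (Measure.pi fun _ : Fin np => classLaw P 1).prod
    ((Measure.pi fun _ : Fin nn => classLaw P (-1)).prod
      (Measure.pi fun _ : Fin nu => unlabeledLaw P))

/-- The nonnegative risk estimator
`π_n R̂_n^-(g) + (1 - a) π_p R̂_p^+(g) + a max {0, R̂_u^+(g) - π_n R̂_n^+(g)}`. -/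
def nonnegRisk (ℓ : ℝ → ℤˣ → ℝ) (P : Measure (X × ℤˣ)) (a : ℝ) {np nn nu : ℕ}
    (S : Data X np nn nu) (g : X → ℝ) : ℝ :=
  classPrior P (-1) * empRisk ℓ (-1) S.2.1 g
    + (1 - a) * classPrior P 1 * empRisk ℓ 1 S.1 g
    + a * max 0 (empRisk ℓ 1 S.2.2 g - classPrior P (-1) * empRisk ℓ 1 S.2.1 g)

/-- The Rademacher complexity
`E_{Z ∼ q^n} E_σ [sup_{g ∈ G} (1/n) ∑ i, σ_i g(Z_i)]`, with `σ` uniform on `{1, -1}^n`. -/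
def rademacher (n : ℕ) (q : Measure X) (G : Set (X → ℝ)) : ℝ :=
  ∫ z : Fin n → X,
    (∑ σ : Fin n → ℤˣ, ⨆ g : G, (1 / (n : ℝ)) * ∑ i, ((σ i : ℤ) : ℝ) * g.1 (z i)) / 2 ^ n
    ∂(Measure.pi fun _ : Fin n => q)

/-- The measurability that makes expectations of suprema over a class `G` meaningful: a supremum
over `g ∈ G` of a continuous function of finitely many values of `g` is a universally measurable
function of the points at which `g` is evaluated. Countable classes of measurable functions, and
classes that are pointwise limits of countable subclasses, have this property. -/
def SupMeasurable (G : Set (X → ℝ)) : Prop :=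
  ∀ (ι : Type) [Fintype ι] (φ : (ι → ℝ) → ℝ), Continuous φ →
    ∀ (ν : Measure (ι → X)) [IsFiniteMeasure ν],
      AEMeasurable (fun z : ι → X => ⨆ g : G, φ (fun i => g.1 (z i))) ν

/-- The bias term
`ε = a π_n C exp (- 2 π_p² ρ² / (C² (1 / n_u + π_n² / n_n)))`. -/
def biasTerm (P : Measure (X × ℤˣ)) (a C ρ : ℝ) (nn nu : ℕ) : ℝ :=
  a * classPrior P (-1) * C *
    Real.exp (-(2 * classPrior P 1 ^ 2 * ρ ^ 2 /
      (C ^ 2 * (1 / (nu : ℝ) + classPrior P (-1) ^ 2 / (nn : ℝ)))))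

end AnomalyRisk

end

open AnomalyRisk

/-!
The risk splits by classes as `R = π_n R_n^- + (1 - a) π_p R_p^+ + a (R_u^+ - π_n R_n^+)`, and the
last bracket equals `π_p R_p^+ ≥ 0`. It is therefore equal to its positive part, and since
`t ↦ max 0 t` is a contraction, the error of the truncated estimator is bounded, for each `g`, by
the errors of the four empirical risks that it is made of (`abs_risk_sub_nonnegRisk_le`). In
particular truncation costs nothing in a two-sided uniform bound, and of the bias term only the
nonnegativity matters. The excess risk of a minimizer is at most twice the uniform error.

The supremum over `G` of `|R_q(g) - R̂_q(g)|` need not be measurable, because it involves the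
population risk. It is replaced by its upper bound `ghostDeviation`, the mean over an independent
ghost sample of the largest difference of two empirical risks, which is universally measurable by
`SupMeasurable`. Two facts about it carry the proof.

* Its mean is at most `4 L` times the Rademacher complexity (`integral_ghostDeviation_le`): exchange
  sample and ghost points at random, and apply the contraction principle
  (`sum_iSup_abs_contraction`) to the loss centred at `0`; the absolute values cost a factor `2`
  because `G` is symmetric.
* It changes by at most `C / n` when one sample point changes, so McDiarmid's inequality
  (`hasSubgaussianMGF_of_bounded_differences`) makes it sub-Gaussian with standard deviation
  `C / (2 √n)` (`hasSubgaussianMGF_ghostDeviation`).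

Standard deviations of sub-Gaussian variables add up, which produces the sum
`(1 + a) π_n / √n_n + (1 - a) π_p / √n_p + a / √n_u` of the bound, with a single tail event for the
four deviations together.
-/

open AnomalyRisk

namespace AnomalyRisk

/-! ### Universal measurability and the bounded-differences inequality -/

/-- A function is universally measurable if it is almost everywhere measurable with respect to
every finite measure. Unlike a.e. measurability for one product measure, this passes to *all*
sections of a function. -/
def UnivMeasurable {Ω : Type*} [MeasurableSpace Ω] (f : Ω → ℝ) : Prop :=
  ∀ (ν : Measure Ω) [IsFiniteMeasure ν], AEMeasurable f ν

lemma UnivMeasurable.comp {Ω Ω' : Type*} [MeasurableSpace Ω] [MeasurableSpace Ω'] {f : Ω' → ℝ}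
    (hf : UnivMeasurable f) {e : Ω → Ω'} (he : Measurable e) :
    UnivMeasurable fun ω => f (e ω) := fun ν _ => (hf (ν.map e)).comp_measurable he

lemma UnivMeasurable.integral_prod_right {Ω Ω' : Type*} [MeasurableSpace Ω] [MeasurableSpace Ω']
    {f : Ω × Ω' → ℝ} (hf : UnivMeasurable f) (μ : Measure Ω') [IsFiniteMeasure μ] :
    UnivMeasurable fun ω => ∫ ω', f (ω, ω') ∂μ := fun ν _ =>
  (hf (ν.prod μ)).aestronglyMeasurable.integral_prod_right'.aemeasurable

lemma UnivMeasurable.integrable {Ω : Type*} [MeasurableSpace Ω] {f : Ω → ℝ}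
    (hf : UnivMeasurable f) {a b : ℝ} (hab : ∀ ω, f ω ∈ Set.Icc a b) (μ : Measure Ω)
    [IsFiniteMeasure μ] : Integrable f μ :=
  Integrable.of_mem_Icc a b (hf μ) (ae_of_all _ hab)

/-- **Hoeffding's lemma** with the range given by an oscillation bound instead of an interval. -/
lemma hasSubgaussianMGF_of_sub_le {Ω : Type*} [MeasurableSpace Ω] {μ : Measure Ω}
    [IsProbabilityMeasure μ] {f : Ω → ℝ} (hf : AEMeasurable f μ) {c : ℝ≥0}
    (hc : ∀ x y, f x - f y ≤ c) :
    HasSubgaussianMGF (fun ω => f ω - ∫ x, f x ∂μ) ((c / 2) ^ 2) μ := by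
  obtain ⟨x₀⟩ : Nonempty Ω := nonempty_of_isProbabilityMeasure μ
  have hbdd : BddBelow (Set.range f) :=
    ⟨f x₀ - c, by rintro _ ⟨x, rfl⟩; linarith [hc x₀ x]⟩
  have : Nonempty Ω := ⟨x₀⟩
  have h := hasSubgaussianMGF_of_mem_Icc (a := ⨅ x, f x) (b := (⨅ x, f x) + c) hf
    (ae_of_all _ fun x => ⟨ciInf_le hbdd x, by
      have : f x - c ≤ ⨅ y, f y := le_ciInf fun y => by linarith [hc x y]
      linarith⟩)
  simpa using h

/-- **McDiarmid's inequality**, in terms of moment generating functions: a function of `n` i.i.d.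
variables that moves by at most `c` when one variable changes is sub-Gaussian with variance proxy
`n (c / 2) ^ 2`. -/
theorem hasSubgaussianMGF_of_bounded_differences {X : Type*} [MeasurableSpace X]
    (μ : Measure X) [IsProbabilityMeasure μ] (c : ℝ≥0) {a b : ℝ} (n : ℕ) (f : (Fin n → X) → ℝ)
    (hf : UnivMeasurable f) (hab : ∀ x, f x ∈ Set.Icc a b)
    (hc : ∀ x i y, f (Function.update x i y) - f x ≤ c) :
    HasSubgaussianMGF (fun x => f x - ∫ x, f x ∂(Measure.pi fun _ => μ)) (n * (c / 2) ^ 2)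
      (Measure.pi fun _ : Fin n => μ) := by
  induction n with
  | zero =>
    have h : ∀ x, f x - ∫ x, f x ∂(Measure.pi fun _ => μ) = 0 := fun x => by
      rw [integral_congr_ae (ae_of_all _ fun y => congrArg f (Subsingleton.elim y x))]
      simp
    simp only [h]
    simp
  | succ n ih =>
    -- Condition on the first variable `x`: the conditional mean `g x` has oscillation at most `c`,
    -- and `f - g x` is a function of the other `n` variables, covered by the induction hypothesis.
    set π := Measure.pi fun _ : Fin n => μ
    have hmp := measurePreserving_piFinSuccAbove (fun _ : Fin (n + 1) => μ) 0
    set e := MeasurableEquiv.piFinSuccAbove (fun _ : Fin (n + 1) => X) 0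
    let F : X × (Fin n → X) → ℝ := fun p => f (e.symm p)
    have hF : UnivMeasurable F := hf.comp e.symm.measurable
    have hFe : ∀ x, F (e x) = f x := fun x => by simp [F]
    have hFab : ∀ p, F p ∈ Set.Icc a b := fun p => hab _
    let g : X → ℝ := fun x => ∫ r, F (x, r) ∂π
    have hsec : ∀ x, UnivMeasurable fun r => F (x, r) := fun x =>
      hF.comp measurable_prodMk_left
    have hg : UnivMeasurable g := hF.integral_prod_right π
    have hgab : ∀ x, g x ∈ Set.Icc a b := fun x => by
      have hi := (hsec x).integrable (fun r => hFab (x, r)) π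
      constructor
      · simpa using integral_mono (μ := π) (integrable_const a) hi fun r => (hFab (x, r)).1
      · simpa using integral_mono (μ := π) hi (integrable_const b) fun r => (hFab (x, r)).2
    have hcons : ∀ x r, e.symm (x, r) = Fin.cons x r := fun x r => by
      simp [e, MeasurableEquiv.piFinSuccAbove, Fin.insertNthEquiv]
    have hgc : ∀ x y, g x - g y ≤ c := fun x y => by
      rw [← integral_sub ((hsec x).integrable (fun r => hFab _) π)
        ((hsec y).integrable (fun r => hFab _) π)]
      have := integral_mono (μ := π) (((hsec x).integrable (fun r => hFab _) π).sub
        ((hsec y).integrable (fun r => hFab _) π)) (integrable_const (c : ℝ)) fun r => by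
          have := hc (e.symm (y, r)) 0 x
          simpa [F, hcons] using this
      simpa using this
    have hm : ∫ x, f x ∂(Measure.pi fun _ => μ) = ∫ x, g x ∂μ := by
      rw [← integral_prod F (hF.integrable hFab _), ← hmp.map_eq,
        integral_map_equiv]
      simp only [hFe]
    set m := ∫ x, f x ∂(Measure.pi fun _ => μ)
    have key : HasSubgaussianMGF (fun p => F p - m) ((n + 1 : ℕ) * (c / 2) ^ 2) (μ.prod π) := by
      have hint : ∀ t : ℝ, Integrable (fun p => Real.exp (t * (F p - m))) (μ.prod π) := fun t =>
        integrable_exp_mul_of_mem_Icc (a := a - m) (b := b - m) ((hF _).sub_const m)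
          (ae_of_all _ fun p => ⟨by linarith [(hFab p).1], by linarith [(hFab p).2]⟩)
      refine ⟨hint, fun t => ?_⟩
      have hgs := hasSubgaussianMGF_of_sub_le (hg μ) hgc
      rw [← hm] at hgs
      rw [mgf, integral_prod _ (hint t)]
      have hin : ∀ x, ∫ r, Real.exp (t * (F (x, r) - m)) ∂π ≤
          Real.exp (t * (g x - m)) * Real.exp ((n * (c / 2) ^ 2 : ℝ≥0) * t ^ 2 / 2) := fun x => by
        have h1 := (ih (fun r => F (x, r)) (hsec x) (fun r => hFab _) (fun r i y => by
          have := hc (e.symm (x, r)) i.succ y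
          simpa only [F, hcons, Fin.cons_update] using this)).mgf_le t
        calc ∫ r, Real.exp (t * (F (x, r) - m)) ∂π
            = ∫ r, Real.exp (t * (g x - m)) * Real.exp (t * (F (x, r) - g x)) ∂π := by
              congr 1; ext r; rw [← Real.exp_add]; ring_nf
          _ = Real.exp (t * (g x - m)) * mgf (fun r => F (x, r) - g x) π t := by
              rw [integral_const_mul, mgf]
          _ ≤ _ := mul_le_mul_of_nonneg_left h1 (Real.exp_nonneg _)
      calc ∫ x, ∫ r, Real.exp (t * (F (x, r) - m)) ∂π ∂μ
          ≤ ∫ x, Real.exp (t * (g x - m)) * Real.exp ((n * (c / 2) ^ 2 : ℝ≥0) * t ^ 2 / 2) ∂μ :=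
            integral_mono (hint t).integral_prod_left
              ((hgs.integrable_exp_mul t).mul_const _) hin
        _ = mgf (fun x => g x - m) μ t * Real.exp ((n * (c / 2) ^ 2 : ℝ≥0) * t ^ 2 / 2) := by
            rw [integral_mul_const, mgf]
        _ ≤ Real.exp (((c / 2) ^ 2 : ℝ≥0) * t ^ 2 / 2) *
              Real.exp ((n * (c / 2) ^ 2 : ℝ≥0) * t ^ 2 / 2) := by
            gcongr; exact hgs.mgf_le t
        _ = _ := by rw [← Real.exp_add]; push_cast; ring_nf
    rw [← hmp.map_eq] at key
    have := key.of_map e.measurable.aemeasurable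
    refine this.congr (ae_of_all _ fun x => ?_)
    simp [hFe]

/-! ### The contraction principle for Rademacher averages -/

lemma sum_units (f : ℤˣ → ℝ) : ∑ s, f s = f 1 + f (-1) := by
  rw [show (Finset.univ : Finset ℤˣ) = {1, -1} from rfl, Finset.sum_pair (by decide)]

lemma abs_unit_mul (s : ℤˣ) (r : ℝ) : |((s : ℤ) : ℝ) * r| = |r| := by
  rcases Int.units_eq_one_or s with rfl | rfl <;> simp

lemma bddAbove_range_of_abs_le {T : Type*} {u : T → ℝ} {B : ℝ} (h : ∀ t, |u t| ≤ B) :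
    BddAbove (Set.range u) :=
  ⟨B, by rintro _ ⟨t, rfl⟩; exact (le_abs_self _).trans (h t)⟩

lemma abs_signed_sum_le {n : ℕ} (σ : Fin n → ℤˣ) {w : Fin n → ℝ} {B : ℝ} (hw : ∀ i, |w i| ≤ B) :
    |∑ i, ((σ i : ℤ) : ℝ) * w i| ≤ n * B :=
  (Finset.abs_sum_le_sum_abs _ _).trans <|
    (Finset.sum_le_sum fun i _ => (abs_unit_mul (σ i) (w i)).le.trans (hw i)).trans (by simp)

/-- The one-coordinate step of the contraction principle. -/
lemma iSup_add_iSup_sub_le {T : Type*} [Nonempty T] {w v p : T → ℝ} {Bw Bv : ℝ}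
    (hw : ∀ t, |w t| ≤ Bw) (hv : ∀ t, |v t| ≤ Bv) (hp : ∀ t s, |p t - p s| ≤ |v t - v s|) :
    (⨆ t, (w t + p t)) + (⨆ t, (w t - p t)) ≤ (⨆ t, (w t + v t)) + ⨆ t, (w t - v t) := by
  have h1 : BddAbove (Set.range fun t => w t + v t) :=
    bddAbove_range_of_abs_le fun t => (abs_add_le _ _).trans (add_le_add (hw t) (hv t))
  have h2 : BddAbove (Set.range fun t => w t - v t) :=
    bddAbove_range_of_abs_le fun t => (abs_sub _ _).trans (add_le_add (hw t) (hv t))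
  refine ciSup_add_ciSup_le fun t s => ?_
  have h3 := le_ciSup h1 t
  have h4 := le_ciSup h1 s
  have h5 := le_ciSup h2 t
  have h6 := le_ciSup h2 s
  have h7 := (le_abs_self _).trans (hp t s)
  rcases abs_cases (v t - v s) with h | h <;> linarith

/-- The **Ledoux–Talagrand contraction principle**, with an additional summand `u` that makes the
induction on the number of coordinates go through. -/
theorem sum_iSup_contraction {T : Type*} [Nonempty T] {ψ : ℝ → ℝ} {L : ℝ≥0}
    (hψ : LipschitzWith L ψ) {B : ℝ} (n : ℕ) (v : T → Fin n → ℝ) (hv : ∀ t i, |v t i| ≤ B)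
    (u : T → ℝ) {Bu : ℝ} (hu : ∀ t, |u t| ≤ Bu) :
    ∑ σ : Fin n → ℤˣ, ⨆ t, (u t + ∑ i, ((σ i : ℤ) : ℝ) * ψ (v t i)) ≤
      ∑ σ : Fin n → ℤˣ, ⨆ t, (u t + ∑ i, ((σ i : ℤ) : ℝ) * (L * v t i)) := by
  induction n generalizing u Bu with
  | zero => simp
  | succ n ih =>
    have hLip : ∀ x y, |ψ x - ψ y| ≤ |L * x - L * y| := fun x y => by
      have := hψ.dist_le_mul x y
      rw [Real.dist_eq, Real.dist_eq] at this
      rwa [← mul_sub, abs_mul, NNReal.abs_eq]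
    have hLv : ∀ t i, |L * v t i| ≤ L * B := fun t i => by
      rw [abs_mul, NNReal.abs_eq]; gcongr; exact hv t i
    have hψv : ∀ t i, |ψ (v t i)| ≤ |ψ 0| + L * B := fun t i => by
      have h1 := hLip (v t i) 0
      have h2 := hLv t i
      have h3 := abs_sub_abs_le_abs_sub (ψ (v t i)) (ψ 0)
      simp only [mul_zero, sub_zero] at h1
      linarith
    have hsplit : ∀ h : (Fin (n + 1) → ℤˣ) → ℝ, ∑ σ, h σ =
        ∑ σ : Fin n → ℤˣ, (h (Fin.cons 1 σ) + h (Fin.cons (-1) σ)) := fun h => by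
      rw [← (Fin.consEquiv fun _ => ℤˣ).sum_comp, Fintype.sum_prod_type, sum_units,
        ← Finset.sum_add_distrib]
      rfl
    rw [hsplit, hsplit]
    simp only [Fin.sum_univ_succ, Fin.cons_zero, Fin.cons_succ, Units.val_one, Units.val_neg,
      Int.cast_one, Int.cast_neg, one_mul, neg_mul]
    calc ∑ σ : Fin n → ℤˣ,
          ((⨆ t, (u t + (ψ (v t 0) + ∑ i, ((σ i : ℤ) : ℝ) * ψ (v t i.succ)))) +
            ⨆ t, (u t + (-ψ (v t 0) + ∑ i, ((σ i : ℤ) : ℝ) * ψ (v t i.succ))))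
        ≤ ∑ σ : Fin n → ℤˣ,
          ((⨆ t, (u t + L * v t 0 + ∑ i, ((σ i : ℤ) : ℝ) * ψ (v t i.succ))) +
            ⨆ t, (u t - L * v t 0 + ∑ i, ((σ i : ℤ) : ℝ) * ψ (v t i.succ))) := by
          refine Finset.sum_le_sum fun σ _ => ?_
          have := iSup_add_iSup_sub_le
            (w := fun t => u t + ∑ i, ((σ i : ℤ) : ℝ) * ψ (v t i.succ))
            (v := fun t => L * v t 0) (p := fun t => ψ (v t 0))
            (fun t => (abs_add_le _ _).trans
              (add_le_add (hu t) (abs_signed_sum_le σ fun i => hψv t i.succ)))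
            (fun t => hLv t 0) fun t s => hLip _ _
          refine le_of_eq_of_le ?_ (this.trans_eq ?_) <;>
            exact congrArg₂ (· + ·) (iSup_congr fun t => by ring) (iSup_congr fun t => by ring)
      _ ≤ _ := by
          rw [Finset.sum_add_distrib, Finset.sum_add_distrib]
          refine add_le_add ?_ ?_
          · refine (ih (fun t i => v t i.succ) (fun t i => hv t _) (fun t => u t + L * v t 0)
              fun t => (abs_add_le _ _).trans (add_le_add (hu t) (hLv t 0))).trans_eq ?_
            simp only [add_assoc]
          · refine (ih (fun t i => v t i.succ) (fun t i => hv t _) (fun t => u t - L * v t 0)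
              fun t => (abs_sub _ _).trans (add_le_add (hu t) (hLv t 0))).trans_eq ?_
            simp only [add_assoc, sub_eq_add_neg]

/-- Contraction for absolute values of Rademacher sums over a symmetric family. Adjoining the zero
vector to the family gives the positive parts of the suprema on the left, and changes nothing on
the right, where symmetry already makes the suprema nonnegative. -/
theorem sum_iSup_abs_contraction {T : Type*} [Nonempty T] {ψ : ℝ → ℝ} {L : ℝ≥0}
    (hψ : LipschitzWith L ψ) (hψ0 : ψ 0 = 0) {B : ℝ} {n : ℕ} (v : T → Fin n → ℝ)
    (hv : ∀ t i, |v t i| ≤ B) (hneg : ∀ t, ∃ s, v s = -v t) :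
    ∑ σ : Fin n → ℤˣ, ⨆ t, |∑ i, ((σ i : ℤ) : ℝ) * ψ (v t i)| ≤
      2 * (L * ∑ σ : Fin n → ℤˣ, ⨆ t, ∑ i, ((σ i : ℤ) : ℝ) * v t i) := by
  obtain ⟨t₀⟩ := ‹Nonempty T›
  have : Nonempty T := ⟨t₀⟩
  have hB : ∀ i : Fin n, 0 ≤ B := fun i => (abs_nonneg _).trans (hv t₀ i)
  let V : Option T → Fin n → ℝ := fun o => o.elim 0 v
  have hV : ∀ o i, |V o i| ≤ B := by
    rintro (_ | t) i
    · simpa [V] using hB i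
    · exact hv t i
  have hψV : ∀ o i, |ψ (V o i)| ≤ L * B := fun o i => by
    have := hψ.dist_le_mul (V o i) 0
    rw [Real.dist_eq, Real.dist_eq, hψ0, sub_zero, sub_zero] at this
    exact this.trans (by gcongr; exact hV o i)
  let A : (Fin n → ℤˣ) → ℝ := fun σ => ⨆ o, ∑ i, ((σ i : ℤ) : ℝ) * ψ (V o i)
  have hA : ∀ σ o, ∑ i, ((σ i : ℤ) : ℝ) * ψ (V o i) ≤ A σ := fun σ o =>
    le_ciSup (f := fun o => ∑ i, ((σ i : ℤ) : ℝ) * ψ (V o i))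
      (bddAbove_range_of_abs_le fun o => abs_signed_sum_le σ fun i => hψV o i) o
  have hA0 : ∀ σ, 0 ≤ A σ := fun σ => by simpa [V, hψ0] using hA σ none
  have h1 : ∀ σ, ⨆ t, |∑ i, ((σ i : ℤ) : ℝ) * ψ (v t i)| ≤ A σ + A (-σ) := fun σ => by
    refine ciSup_le fun t => abs_le'.2 ⟨?_, ?_⟩
    · exact (hA σ (some t)).trans (le_add_of_nonneg_right (hA0 (-σ)))
    · have := hA (-σ) (some t)
      simp only [Pi.neg_apply, Units.val_neg, Int.cast_neg, neg_mul, Finset.sum_neg_distrib] at this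
      exact this.trans (le_add_of_nonneg_left (hA0 σ))
  have h2 : ∑ σ, A (-σ) = ∑ σ, A σ := Equiv.sum_comp (Equiv.neg (Fin n → ℤˣ)) A
  have h3 : ∑ σ, A σ ≤ ∑ σ : Fin n → ℤˣ, ⨆ o, ∑ i, ((σ i : ℤ) : ℝ) * (L * V o i) := by
    simpa [A] using sum_iSup_contraction hψ n V hV (fun _ => 0) (Bu := 0) (by simp)
  have h4 : ∀ σ : Fin n → ℤˣ, ⨆ o, ∑ i, ((σ i : ℤ) : ℝ) * (L * V o i) ≤
      L * ⨆ t, ∑ i, ((σ i : ℤ) : ℝ) * v t i := fun σ => by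
    have hbdd : BddAbove (Set.range fun t => ∑ i, ((σ i : ℤ) : ℝ) * v t i) :=
      bddAbove_range_of_abs_le fun t => abs_signed_sum_le σ fun i => hv t i
    have hpull : ∀ w : Fin n → ℝ, ∑ i, ((σ i : ℤ) : ℝ) * (L * w i) =
        L * ∑ i, ((σ i : ℤ) : ℝ) * w i := fun w => by
      rw [Finset.mul_sum]; exact Finset.sum_congr rfl fun i _ => by ring
    refine ciSup_le fun o => ?_
    rw [hpull]
    refine mul_le_mul_of_nonneg_left ?_ L.coe_nonneg
    rcases o with _ | t
    · obtain ⟨s, hs⟩ := hneg t₀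
      have e1 := le_ciSup hbdd t₀
      have e2 := le_ciSup hbdd s
      simp only [hs, Pi.neg_apply, mul_neg, Finset.sum_neg_distrib] at e1 e2
      simp only [V, Option.elim_none, Pi.zero_apply, mul_zero, Finset.sum_const_zero]
      linarith
    · exact le_ciSup hbdd t
  calc _ ≤ ∑ σ, (A σ + A (-σ)) := Finset.sum_le_sum fun σ _ => h1 σ
    _ = 2 * ∑ σ, A σ := by rw [Finset.sum_add_distrib, h2]; ring
    _ ≤ 2 * (L * ∑ σ : Fin n → ℤˣ, ⨆ t, ∑ i, ((σ i : ℤ) : ℝ) * v t i) := by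
      rw [Finset.mul_sum _ _ (L : ℝ)]
      refine mul_le_mul_of_nonneg_left ?_ zero_le_two
      exact h3.trans (Finset.sum_le_sum fun σ _ => h4 σ)

/-! ### Deviations from a ghost sample -/

/-- The largest deviation, over `g ∈ G`, between the empirical risks of two samples. -/
noncomputable def supDeviation {X : Type*} (ℓ : ℝ → ℤˣ → ℝ) (y : ℤˣ) (G : Set (X → ℝ)) {n : ℕ}
    (S S' : Fin n → X) : ℝ :=
  ⨆ g : G, |empRisk ℓ y S' g - empRisk ℓ y S g|

/-- The expected largest deviation of the empirical risk of `S` from that of an independent ghost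
sample of the same size drawn from `q`. It dominates the deviation of the empirical risk from the
population risk (`abs_lawRisk_sub_empRisk_le`), and unlike the supremum over `G` of the latter it
is measurable under `SupMeasurable G`. -/
noncomputable def ghostDeviation {X : Type*} [MeasurableSpace X] (ℓ : ℝ → ℤˣ → ℝ) (y : ℤˣ)
    (q : Measure X) (G : Set (X → ℝ)) {n : ℕ} (S : Fin n → X) : ℝ :=
  ∫ S', supDeviation ℓ y G S S' ∂(Measure.pi fun _ : Fin n => q)

/-- The empirical Rademacher complexity of `G` at the sample `z`. -/
noncomputable def empRademacher {X : Type*} (G : Set (X → ℝ)) {n : ℕ} (z : Fin n → X) : ℝ :=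
  (∑ σ : Fin n → ℤˣ, ⨆ g : G, (1 / (n : ℝ)) * ∑ i, ((σ i : ℤ) : ℝ) * g.1 (z i)) / 2 ^ n

section

variable {X : Type*} {G : Set (X → ℝ)} {Cg C : ℝ} {ℓ : ℝ → ℤˣ → ℝ} {L : ℝ≥0} {y : ℤˣ} {n : ℕ}

lemma empRisk_mem_Icc (hℓ : ∀ t, ℓ t y ∈ Set.Icc 0 C) (S : Fin n → X) (g : X → ℝ) :
    empRisk ℓ y S g ∈ Set.Icc 0 C := by
  have hC : 0 ≤ C := (hℓ 0).1.trans (hℓ 0).2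
  refine ⟨mul_nonneg (by positivity) (Finset.sum_nonneg fun i _ => (hℓ _).1), ?_⟩
  have h : ∑ i, ℓ (g (S i)) y ≤ n * C := by
    simpa using Finset.sum_le_sum fun (i : Fin n) (_ : i ∈ Finset.univ) => (hℓ (g (S i))).2
  rcases Nat.eq_zero_or_pos n with rfl | hn
  · simpa [empRisk] using hC
  · have : (0 : ℝ) < n := by exact_mod_cast hn
    rw [empRisk, one_div, inv_mul_le_iff₀ this]
    exact h

lemma abs_empRisk_sub_le (hℓ : ∀ t, ℓ t y ∈ Set.Icc 0 C) (S S' : Fin n → X) (g : X → ℝ) :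
    |empRisk ℓ y S' g - empRisk ℓ y S g| ≤ C := by
  have h1 := empRisk_mem_Icc hℓ S g
  have h2 := empRisk_mem_Icc hℓ S' g
  exact abs_le.2 ⟨by linarith [h1.2, h2.1], by linarith [h1.1, h2.2]⟩

lemma bddAbove_deviation (hℓ : ∀ t, ℓ t y ∈ Set.Icc 0 C) (S S' : Fin n → X) :
    BddAbove (Set.range fun g : G => |empRisk ℓ y S' g - empRisk ℓ y S g|) :=
  bddAbove_range_of_abs_le fun g => (abs_abs _).trans_le (abs_empRisk_sub_le hℓ S S' g.1)

lemma supDeviation_mem_Icc (hℓ : ∀ t, ℓ t y ∈ Set.Icc 0 C) (S S' : Fin n → X) :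
    supDeviation ℓ y G S S' ∈ Set.Icc 0 C :=
  ⟨Real.iSup_nonneg fun _ => abs_nonneg _,
    Real.iSup_le (fun g => abs_empRisk_sub_le hℓ S S' g.1) ((hℓ 0).1.trans (hℓ 0).2)⟩

/-- Replacing one sample point moves the largest deviation by at most `C / n`. -/
lemma supDeviation_update_sub_le (hGne : G.Nonempty) (hℓ : ∀ t, ℓ t y ∈ Set.Icc 0 C)
    (S S' : Fin n → X) (i : Fin n) (x : X) :
    supDeviation ℓ y G (Function.update S i x) S' - supDeviation ℓ y G S S' ≤ C / n := by
  have : Nonempty G := hGne.to_subtype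
  have hn : (0 : ℝ) < n := by exact_mod_cast i.pos
  rw [sub_le_iff_le_add]
  refine ciSup_le fun g => ?_
  have h1 := le_ciSup (bddAbove_deviation hℓ S S') g
  have h2 : empRisk ℓ y (Function.update S i x) g.1 - empRisk ℓ y S g.1 =
      1 / n * (ℓ (g.1 x) y - ℓ (g.1 (S i)) y) := by
    rw [empRisk, empRisk, ← mul_sub, ← Finset.sum_sub_distrib, Finset.sum_eq_single i]
    · simp
    · intro j _ hj; simp [hj]
    · simp
  have h3 : |empRisk ℓ y (Function.update S i x) g.1 - empRisk ℓ y S g.1| ≤ C / n := by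
    rw [h2, abs_mul, abs_of_nonneg (by positivity : (0 : ℝ) ≤ 1 / n), one_div, div_eq_inv_mul]
    refine mul_le_mul_of_nonneg_left ?_ (by positivity)
    have e1 := hℓ (g.1 x)
    have e2 := hℓ (g.1 (S i))
    exact abs_le.2 ⟨by linarith [e1.1, e2.2], by linarith [e1.2, e2.1]⟩
  calc |empRisk ℓ y S' g.1 - empRisk ℓ y (Function.update S i x) g.1|
      ≤ |empRisk ℓ y S' g.1 - empRisk ℓ y S g.1| +
          |empRisk ℓ y S g.1 - empRisk ℓ y (Function.update S i x) g.1| := abs_sub_le _ _ _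
    _ ≤ _ := by
      rw [abs_sub_comm (empRisk ℓ y S g.1), add_comm]
      exact add_le_add h3 h1

lemma empRademacher_term_abs_le (hGbdd : ∀ g ∈ G, ∀ x, |g x| ≤ Cg) (σ : Fin n → ℤˣ)
    (z : Fin n → X) (g : G) :
    |(1 / (n : ℝ)) * ∑ i, ((σ i : ℤ) : ℝ) * g.1 (z i)| ≤ 1 / n * (n * Cg) := by
  rw [abs_mul, abs_of_nonneg (by positivity : (0 : ℝ) ≤ 1 / n)]
  gcongr
  exact abs_signed_sum_le σ fun i => hGbdd g g.2 _

end

section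

variable {X : Type*} [MeasurableSpace X] {G : Set (X → ℝ)} {Cg C : ℝ} {ℓ : ℝ → ℤˣ → ℝ} {L : ℝ≥0}
  {y : ℤˣ} {n : ℕ} {q : Measure X}

lemma SupMeasurable.univMeasurable (hG : SupMeasurable G) {ι : Type} [Fintype ι]
    {φ : (ι → ℝ) → ℝ} (hφ : Continuous φ) :
    UnivMeasurable fun z : ι → X => ⨆ g : G, φ fun i => g.1 (z i) := fun ν _ => hG ι φ hφ ν

lemma univMeasurable_supDeviation (hG : SupMeasurable G) (hcont : Continuous fun t => ℓ t y) :
    UnivMeasurable fun p : (Fin n → X) × (Fin n → X) => supDeviation ℓ y G p.1 p.2 := by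
  have h := hG.univMeasurable (ι := Fin n ⊕ Fin n)
    (φ := fun w => |(1 / (n : ℝ)) * ∑ i, ℓ (w (Sum.inr i)) y -
      (1 / (n : ℝ)) * ∑ i, ℓ (w (Sum.inl i)) y|) (by
        have : ∀ j : Fin n ⊕ Fin n, Continuous fun w : Fin n ⊕ Fin n → ℝ => ℓ (w j) y :=
          fun j => hcont.comp (continuous_apply j)
        fun_prop)
  exact h.comp (e := fun p : (Fin n → X) × (Fin n → X) => Sum.elim p.1 p.2)
    (measurable_pi_iff.2 (by rintro (i | i) <;> simp <;> fun_prop))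

lemma univMeasurable_supDeviation_right (hG : SupMeasurable G)
    (hcont : Continuous fun t => ℓ t y) (S : Fin n → X) :
    UnivMeasurable fun S' => supDeviation ℓ y G S S' :=
  (univMeasurable_supDeviation hG hcont).comp (e := fun S' => (S, S')) measurable_prodMk_left

variable [IsProbabilityMeasure q]

lemma integrable_supDeviation (hG : SupMeasurable G) (hcont : Continuous fun t => ℓ t y)
    (hℓ : ∀ t, ℓ t y ∈ Set.Icc 0 C) (S : Fin n → X) :
    Integrable (supDeviation ℓ y G S) (Measure.pi fun _ : Fin n => q) :=
  (univMeasurable_supDeviation_right hG hcont S).integrable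
    (fun S' => supDeviation_mem_Icc hℓ S S') _

lemma ghostDeviation_mem_Icc (hG : SupMeasurable G) (hcont : Continuous fun t => ℓ t y)
    (hℓ : ∀ t, ℓ t y ∈ Set.Icc 0 C) (S : Fin n → X) :
    ghostDeviation ℓ y q G S ∈ Set.Icc 0 C := by
  refine ⟨integral_nonneg fun S' => (supDeviation_mem_Icc hℓ S S').1, ?_⟩
  simpa [ghostDeviation] using integral_mono (integrable_supDeviation hG hcont hℓ S)
    (integrable_const (μ := Measure.pi fun _ : Fin n => q) C)
    fun S' => (supDeviation_mem_Icc hℓ S S').2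

lemma univMeasurable_ghostDeviation (hG : SupMeasurable G) (hcont : Continuous fun t => ℓ t y) :
    UnivMeasurable fun S : Fin n → X => ghostDeviation ℓ y q G S :=
  (univMeasurable_supDeviation hG hcont).integral_prod_right _

/-- The concentration of the ghost deviation around its mean. -/
lemma hasSubgaussianMGF_ghostDeviation (hGne : G.Nonempty) (hG : SupMeasurable G)
    (hcont : Continuous fun t => ℓ t y) {C : ℝ≥0} (hℓ : ∀ t, ℓ t y ∈ Set.Icc 0 (C : ℝ)) :
    HasSubgaussianMGF (fun S : Fin n → X => ghostDeviation ℓ y q G S -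
        ∫ S, ghostDeviation ℓ y q G S ∂(Measure.pi fun _ : Fin n => q))
      (n * (C / n / 2) ^ 2) (Measure.pi fun _ : Fin n => q) := by
  refine hasSubgaussianMGF_of_bounded_differences q (C / n) n _
    (univMeasurable_ghostDeviation hG hcont) (ghostDeviation_mem_Icc hG hcont hℓ) fun S i x => ?_
  rw [ghostDeviation, ghostDeviation, ← integral_sub (integrable_supDeviation hG hcont hℓ _)
    (integrable_supDeviation hG hcont hℓ _)]
  simpa using integral_mono ((integrable_supDeviation (q := q) hG hcont hℓ
    (Function.update S i x)).sub (integrable_supDeviation hG hcont hℓ S))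
    (integrable_const (C / n : ℝ)) fun S' => supDeviation_update_sub_le hGne hℓ S S' i x

lemma lawRisk_eq_integral_empRisk (hn : 0 < n) {g : X → ℝ} (hg : Measurable g)
    (hcont : Continuous fun t => ℓ t y) (hℓ : ∀ t, ℓ t y ∈ Set.Icc 0 C) :
    lawRisk ℓ q y g = ∫ S, empRisk ℓ y S g ∂(Measure.pi fun _ : Fin n => q) := by
  have hm : Measurable fun x => ℓ (g x) y := hcont.measurable.comp hg
  have hi : ∀ i : Fin n, Integrable (fun S : Fin n → X => ℓ (g (S i)) y)
      (Measure.pi fun _ : Fin n => q) := fun i =>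
    Integrable.of_mem_Icc 0 C (hm.comp (measurable_pi_apply i)).aemeasurable
      (ae_of_all _ fun S => hℓ _)
  have he : ∀ i : Fin n, ∫ S : Fin n → X, ℓ (g (S i)) y ∂(Measure.pi fun _ : Fin n => q) =
      lawRisk ℓ q y g := fun i =>
    integral_comp_eval (μ := fun _ : Fin n => q) (i := i) hm.aestronglyMeasurable
  simp only [empRisk]
  rw [integral_const_mul, integral_finsetSum _ fun i _ => hi i]
  simp only [he, Finset.sum_const, Finset.card_univ, Fintype.card_fin, nsmul_eq_mul]
  have : (n : ℝ) ≠ 0 := by exact_mod_cast hn.ne'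
  field_simp

lemma integrable_empRisk {g : X → ℝ} (hg : Measurable g)
    (hcont : Continuous fun t => ℓ t y) (hℓ : ∀ t, ℓ t y ∈ Set.Icc 0 C) :
    Integrable (fun S => empRisk ℓ y S g) (Measure.pi fun _ : Fin n => q) := by
  have hm : Measurable fun x => ℓ (g x) y := hcont.measurable.comp hg
  refine Integrable.of_mem_Icc 0 C (Measurable.aemeasurable ?_)
    (ae_of_all _ fun S => empRisk_mem_Icc hℓ S g)
  exact (Finset.measurable_fun_sum _ fun i _ => hm.comp (measurable_pi_apply i)).const_mul _

/-- The population risk is the mean of the empirical risk of a ghost sample, so Jensen's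
inequality bounds its distance from the empirical risk, uniformly over `G`. -/
lemma abs_lawRisk_sub_empRisk_le (hn : 0 < n) (hG : SupMeasurable G) {g : X → ℝ} (hgG : g ∈ G)
    (hg : Measurable g) (hcont : Continuous fun t => ℓ t y) (hℓ : ∀ t, ℓ t y ∈ Set.Icc 0 C)
    (S : Fin n → X) :
    |lawRisk ℓ q y g - empRisk ℓ y S g| ≤ ghostDeviation ℓ y q G S := by
  have hi := integrable_empRisk (q := q) (n := n) hg hcont hℓ
  have h : lawRisk ℓ q y g - empRisk ℓ y S g =
      ∫ S', (empRisk ℓ y S' g - empRisk ℓ y S g) ∂(Measure.pi fun _ : Fin n => q) := by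
    rw [integral_sub hi (integrable_const _), ← lawRisk_eq_integral_empRisk hn hg hcont hℓ]
    simp
  rw [h]
  refine abs_integral_le_integral_abs.trans (integral_mono (hi.sub (integrable_const _)).abs
    (integrable_supDeviation hG hcont hℓ S) fun S' => ?_)
  exact le_ciSup (bddAbove_deviation hℓ S S') (⟨g, hgG⟩ : G)

/-! ### Symmetrization -/

/-- The permutation of two copies of `Fin n` that exchanges the two copies of `i` exactly when
`σ i = -1`. -/
def signSwap (σ : Fin n → ℤˣ) : Equiv.Perm (Fin n ⊕ Fin n) :=
  Function.Involutive.toPerm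
    (fun j => j.elim (fun i => if σ i = 1 then Sum.inl i else Sum.inr i)
      (fun i => if σ i = 1 then Sum.inr i else Sum.inl i))
    (by rintro (i | i) <;> by_cases h : σ i = 1 <;> simp [h])

lemma signSwap_inl (σ : Fin n → ℤˣ) (i : Fin n) :
    signSwap σ (Sum.inl i) = if σ i = 1 then Sum.inl i else Sum.inr i := rfl

lemma signSwap_inr (σ : Fin n → ℤˣ) (i : Fin n) :
    signSwap σ (Sum.inr i) = if σ i = 1 then Sum.inr i else Sum.inl i := rfl

lemma integral_comp_perm {ι : Type*} [Fintype ι] (e : Equiv.Perm ι) (f : (ι → X) → ℝ) :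
    ∫ z, f (fun i => z (e i)) ∂(Measure.pi fun _ : ι => q) =
      ∫ z, f z ∂(Measure.pi fun _ : ι => q) := by
  have h := measurePreserving_piCongrLeft (fun _ : ι => q) e.symm
  rw [← h.integral_comp' (g := f)]
  congr 1
  ext z
  congr 1
  ext i
  have := Equiv.piCongrLeft_apply_apply (fun _ : ι => X) e.symm z (e i)
  rw [Equiv.symm_apply_apply] at this
  exact this.symm

lemma measurePreserving_comp_inl :
    MeasurePreserving (fun (z : Fin n ⊕ Fin n → X) i => z (Sum.inl i))
      (Measure.pi fun _ => q) (Measure.pi fun _ => q) :=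
  measurePreserving_fst.comp (measurePreserving_sumPiEquivProdPi fun _ : Fin n ⊕ Fin n => q)

lemma measurePreserving_comp_inr :
    MeasurePreserving (fun (z : Fin n ⊕ Fin n → X) i => z (Sum.inr i))
      (Measure.pi fun _ => q) (Measure.pi fun _ => q) :=
  measurePreserving_snd.comp (measurePreserving_sumPiEquivProdPi fun _ : Fin n ⊕ Fin n => q)

lemma integrable_empRademacher (hGne : G.Nonempty) (hG : SupMeasurable G)
    (hGbdd : ∀ g ∈ G, ∀ x, |g x| ≤ Cg) :
    Integrable (fun z : Fin n → X => empRademacher G z) (Measure.pi fun _ => q) := by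
  obtain ⟨g₀, hg₀⟩ := hGne
  have : Nonempty G := ⟨⟨g₀, hg₀⟩⟩
  refine (integrable_finsetSum _ fun σ _ => ?_).div_const _
  refine (hG.univMeasurable (ι := Fin n)
    (φ := fun w => (1 / (n : ℝ)) * ∑ i, ((σ i : ℤ) : ℝ) * w i) (by fun_prop)).integrable
    (a := -(1 / n * (n * Cg))) (b := 1 / n * (n * Cg)) (fun z => ⟨?_, ?_⟩) _
  · exact (abs_le.1 (empRademacher_term_abs_le hGbdd σ z ⟨g₀, hg₀⟩)).1.trans
      (le_ciSup (f := fun g : G => (1 / (n : ℝ)) * ∑ i, ((σ i : ℤ) : ℝ) * g.1 (z i))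
        (bddAbove_range_of_abs_le (empRademacher_term_abs_le hGbdd σ z)) _)
  · exact ciSup_le fun g => (abs_le.1 (empRademacher_term_abs_le hGbdd σ z g)).2

end

section

variable {X : Type*} {G : Set (X → ℝ)} {Cg C : ℝ} {ℓ : ℝ → ℤˣ → ℝ} {L : ℝ≥0} {y : ℤˣ} {n : ℕ}

/-- Averaged over all exchanges of sample points with ghost points, the largest deviation is
controlled by the empirical Rademacher complexities of the two samples. Centring the loss at `0`
does not change differences of empirical risks, and makes the contraction principle applicable. -/
lemma sum_supDeviation_signSwap_le (hGne : G.Nonempty) (hGbdd : ∀ g ∈ G, ∀ x, |g x| ≤ Cg)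
    (hGneg : ∀ g ∈ G, -g ∈ G) (hLip : LipschitzWith L fun t => ℓ t y)
    (z : Fin n ⊕ Fin n → X) :
    ∑ σ : Fin n → ℤˣ, supDeviation ℓ y G (fun i => z (signSwap σ (Sum.inl i)))
        (fun i => z (signSwap σ (Sum.inr i))) ≤
      2 ^ n * (2 * L * (empRademacher G (fun i => z (Sum.inl i)) +
        empRademacher G (fun i => z (Sum.inr i)))) := by
  have : Nonempty G := hGne.to_subtype
  set ψ : ℝ → ℝ := fun t => ℓ t y - ℓ 0 y with hψ_def
  have hψ : LipschitzWith L ψ := LipschitzWith.of_dist_le_mul fun s t => by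
    simpa [ψ] using hLip.dist_le_mul s t
  have hψB : ∀ (g : G) x, |ψ (g.1 x)| ≤ L * Cg := fun g x => by
    have := hψ.dist_le_mul (g.1 x) 0
    rw [Real.dist_eq, Real.dist_eq] at this
    simp only [hψ_def, sub_self, sub_zero] at this ⊢
    exact this.trans (by gcongr; exact hGbdd g g.2 x)
  have hn : (0 : ℝ) ≤ 1 / n := by positivity
  let A : (Fin n → X) → (Fin n → ℤˣ) → ℝ := fun x σ =>
    ⨆ g : G, |∑ i, ((σ i : ℤ) : ℝ) * ψ (g.1 (x i))|
  have hA : ∀ x σ (g : G), |∑ i, ((σ i : ℤ) : ℝ) * ψ (g.1 (x i))| ≤ A x σ := fun x σ g =>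
    le_ciSup (f := fun g : G => |∑ i, ((σ i : ℤ) : ℝ) * ψ (g.1 (x i))|)
      (bddAbove_range_of_abs_le fun g => (abs_abs _).trans_le
        (abs_signed_sum_le σ fun i => hψB g (x i))) g
  have hAR : ∀ x : Fin n → X, 1 / n * ∑ σ, A x σ ≤ 2 ^ n * (2 * L * empRademacher G x) :=
    fun x => by
      have h := sum_iSup_abs_contraction hψ (by simp [ψ]) (fun (g : G) i => g.1 (x i))
        (fun g i => hGbdd g g.2 _) fun g => ⟨⟨-g.1, hGneg g g.2⟩, rfl⟩
      calc 1 / n * ∑ σ, A x σ ≤ 1 / n * (2 * (L * ∑ σ : Fin n → ℤˣ,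
            ⨆ g : G, ∑ i, ((σ i : ℤ) : ℝ) * g.1 (x i))) := mul_le_mul_of_nonneg_left h hn
        _ = 2 ^ n * (2 * L * empRademacher G x) := by
            simp only [empRademacher, ← Real.mul_iSup_of_nonneg hn, ← Finset.mul_sum]
            field_simp
  have hσ : ∀ σ : Fin n → ℤˣ, supDeviation ℓ y G (fun i => z (signSwap σ (Sum.inl i)))
        (fun i => z (signSwap σ (Sum.inr i))) ≤
      1 / n * (A (fun i => z (Sum.inl i)) σ + A (fun i => z (Sum.inr i)) σ) := fun σ => by
    refine ciSup_le fun g => ?_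
    have h : empRisk ℓ y (fun i => z (signSwap σ (Sum.inr i))) g.1 -
        empRisk ℓ y (fun i => z (signSwap σ (Sum.inl i))) g.1 =
        1 / n * (∑ i, ((σ i : ℤ) : ℝ) * ψ (g.1 (z (Sum.inr i))) -
          ∑ i, ((σ i : ℤ) : ℝ) * ψ (g.1 (z (Sum.inl i)))) := by
      rw [empRisk, empRisk, ← mul_sub, ← Finset.sum_sub_distrib, ← Finset.sum_sub_distrib]
      congr 1
      refine Finset.sum_congr rfl fun i _ => ?_
      rcases Int.units_eq_one_or (σ i) with h | h <;> simp [signSwap_inl, signSwap_inr, h, ψ]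
    rw [h, abs_mul, abs_of_nonneg hn]
    refine mul_le_mul_of_nonneg_left ?_ hn
    refine (abs_sub _ _).trans ?_
    rw [add_comm]
    exact add_le_add (hA (fun i => z (Sum.inl i)) σ g) (hA (fun i => z (Sum.inr i)) σ g)
  calc _ ≤ ∑ σ, 1 / n * (A (fun i => z (Sum.inl i)) σ + A (fun i => z (Sum.inr i)) σ) :=
        Finset.sum_le_sum fun σ _ => hσ σ
    _ = 1 / n * ∑ σ, A (fun i => z (Sum.inl i)) σ +
          1 / n * ∑ σ, A (fun i => z (Sum.inr i)) σ := by
        rw [← Finset.mul_sum, Finset.sum_add_distrib, mul_add]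
    _ ≤ _ := by
        refine (add_le_add (hAR _) (hAR _)).trans_eq ?_
        ring

end

section

variable {X : Type*} [MeasurableSpace X] {G : Set (X → ℝ)} {Cg C : ℝ} {ℓ : ℝ → ℤˣ → ℝ} {L : ℝ≥0}
  {y : ℤˣ} {n : ℕ} {q : Measure X} [IsProbabilityMeasure q]

/-- **Symmetrization**: the mean of the ghost deviation is at most `4 L` times the Rademacher
complexity. -/
theorem integral_ghostDeviation_le (hGne : G.Nonempty) (hG : SupMeasurable G)
    (hGbdd : ∀ g ∈ G, ∀ x, |g x| ≤ Cg) (hGneg : ∀ g ∈ G, -g ∈ G)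
    (hLip : LipschitzWith L fun t => ℓ t y) (hℓ : ∀ t, ℓ t y ∈ Set.Icc 0 C) :
    ∫ S, ghostDeviation ℓ y q G S ∂(Measure.pi fun _ : Fin n => q) ≤ 4 * L * rademacher n q G := by
  set Q := Measure.pi fun _ : Fin n ⊕ Fin n => q with hQ
  let H : (Fin n ⊕ Fin n → X) → ℝ := fun z =>
    supDeviation ℓ y G (fun i => z (Sum.inl i)) (fun i => z (Sum.inr i))
  have hmp := measurePreserving_sumPiEquivProdPi fun _ : Fin n ⊕ Fin n => q
  have hUM := univMeasurable_supDeviation (n := n) hG hLip.continuous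
  have hH : UnivMeasurable H :=
    hUM.comp (e := fun z : Fin n ⊕ Fin n → X => (fun i => z (Sum.inl i), fun i => z (Sum.inr i)))
      (by fun_prop)
  have h1 : ∫ S, ghostDeviation ℓ y q G S ∂(Measure.pi fun _ : Fin n => q) = ∫ z, H z ∂Q := by
    have h : ∫ p : (Fin n → X) × (Fin n → X), supDeviation ℓ y G p.1 p.2
          ∂((Measure.pi fun _ : Fin n => q).prod (Measure.pi fun _ : Fin n => q)) =
        ∫ S, ghostDeviation ℓ y q G S ∂(Measure.pi fun _ : Fin n => q) :=
      integral_prod _ (hUM.integrable (fun p => supDeviation_mem_Icc hℓ p.1 p.2) _)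
    rw [← h]
    exact (hmp.integral_comp' (g := fun p => supDeviation ℓ y G p.1 p.2)).symm
  have hperm : ∀ e : Equiv.Perm (Fin n ⊕ Fin n), Measurable
      fun (z : Fin n ⊕ Fin n → X) j => z (e j) := fun e =>
    measurable_pi_iff.2 fun j => measurable_pi_apply _
  have hint : ∀ σ : Fin n → ℤˣ, Integrable (fun z => H fun j => z (signSwap σ j)) Q := fun σ =>
    (hH.comp (hperm _)).integrable (fun z => supDeviation_mem_Icc hℓ _ _) Q
  have h2 : 2 ^ n * ∫ z, H z ∂Q = ∫ z, ∑ σ : Fin n → ℤˣ, H (fun j => z (signSwap σ j)) ∂Q := by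
    rw [integral_finsetSum _ fun σ _ => hint σ]
    simp only [hQ, integral_comp_perm]
    simp
  have hRl := measurePreserving_comp_inl (q := q) (n := n)
  have hRr := measurePreserving_comp_inr (q := q) (n := n)
  have hR := integrable_empRademacher (q := q) (n := n) hGne hG hGbdd
  have hil : Integrable (fun z : Fin n ⊕ Fin n → X => empRademacher G fun i => z (Sum.inl i)) Q :=
    hRl.integrable_comp_of_integrable hR
  have hir : Integrable (fun z : Fin n ⊕ Fin n → X => empRademacher G fun i => z (Sum.inr i)) Q :=
    hRr.integrable_comp_of_integrable hR
  have hel : ∫ z : Fin n ⊕ Fin n → X, empRademacher G (fun i => z (Sum.inl i)) ∂Q =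
      rademacher n q G := by
    rw [← integral_map (f := fun z => empRademacher G z) hRl.aemeasurable (by
      rw [hRl.map_eq]; exact hR.aestronglyMeasurable), hRl.map_eq]
    rfl
  have her : ∫ z : Fin n ⊕ Fin n → X, empRademacher G (fun i => z (Sum.inr i)) ∂Q =
      rademacher n q G := by
    rw [← integral_map (f := fun z => empRademacher G z) hRr.aemeasurable (by
      rw [hRr.map_eq]; exact hR.aestronglyMeasurable), hRr.map_eq]
    rfl
  have h3 : ∫ z, ∑ σ : Fin n → ℤˣ, H (fun j => z (signSwap σ j)) ∂Q ≤
      2 ^ n * (4 * L * rademacher n q G) := by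
    have hpt : ∀ z : Fin n ⊕ Fin n → X, ∑ σ : Fin n → ℤˣ, H (fun j => z (signSwap σ j)) ≤
        2 ^ n * (2 * L * (empRademacher G (fun i => z (Sum.inl i)) +
          empRademacher G (fun i => z (Sum.inr i)))) :=
      fun z => sum_supDeviation_signSwap_le hGne hGbdd hGneg hLip z
    have hbound : Integrable (fun z : Fin n ⊕ Fin n → X =>
        2 ^ n * (2 * L * (empRademacher G (fun i => z (Sum.inl i)) +
          empRademacher G (fun i => z (Sum.inr i))))) Q :=
      ((hil.add hir).const_mul (2 * L : ℝ)).const_mul (2 ^ n)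
    refine (integral_mono (integrable_finsetSum _ fun σ _ => hint σ) hbound hpt).trans_eq ?_
    rw [integral_const_mul, integral_const_mul, integral_add hil hir, hel, her]
    ring
  rw [h1]
  exact le_of_mul_le_mul_left (h2.trans_le h3) (by positivity)

end

/-! ### Sub-Gaussian variables parametrized by standard deviation -/

section

variable {Ω : Type*} [MeasurableSpace Ω] {μ : Measure Ω} {U V : Ω → ℝ} {s t : ℝ≥0}

lemma hasSubgaussianMGF_add_sq (hU : HasSubgaussianMGF U (s ^ 2) μ)
    (hV : HasSubgaussianMGF V (t ^ 2) μ) :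
    HasSubgaussianMGF (fun ω => U ω + V ω) ((s + t) ^ 2) μ := by
  simpa using hU.add hV

lemma hasSubgaussianMGF_const_mul_sq (hU : HasSubgaussianMGF U (s ^ 2) μ) (r : ℝ≥0) :
    HasSubgaussianMGF (fun ω => r * U ω) ((r * s) ^ 2) μ := by
  rw [mul_pow]
  exact hU.const_mul r

end

/-! ### Decomposition of the risk by classes -/

section

variable {X : Type*} [MeasurableSpace X] {P : Measure (X × ℤˣ)}

lemma measurableSet_label (y : ℤˣ) : MeasurableSet {z : X × ℤˣ | z.2 = y} := by
  have h : Measurable fun z : X × ℤˣ => (z.2 : ℤ) :=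
    (comap_measurable (Units.val : ℤˣ → ℤ)).comp measurable_snd
  have h' : {z : X × ℤˣ | z.2 = y} = (fun z : X × ℤˣ => (z.2 : ℤ)) ⁻¹' {(y : ℤ)} := by
    ext z; simp [Units.val_inj]
  rw [h']
  exact h (measurableSet_singleton _)

lemma isProbabilityMeasure_classLaw [IsProbabilityMeasure P] {y : ℤˣ} (hy : 0 < classPrior P y) :
    IsProbabilityMeasure (classLaw P y) := by
  have h : P {z | z.2 = y} ≠ 0 := fun h => by
    simp [classPrior, Measure.real, h] at hy
  have := cond_isProbabilityMeasure h
  exact Measure.isProbabilityMeasure_map measurable_fst.aemeasurable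

instance [IsProbabilityMeasure P] : IsProbabilityMeasure (unlabeledLaw P) :=
  Measure.isProbabilityMeasure_map measurable_fst.aemeasurable

lemma setIntegral_label [IsProbabilityMeasure P] {y : ℤˣ} (hy : 0 < classPrior P y) {h : X → ℝ}
    (hm : Measurable h) :
    ∫ z in {z : X × ℤˣ | z.2 = y}, h z.1 ∂P = classPrior P y * ∫ x, h x ∂(classLaw P y) := by
  rw [classLaw, integral_map measurable_fst.aemeasurable hm.aestronglyMeasurable,
    ProbabilityTheory.cond, integral_smul_measure, ENNReal.toReal_inv, smul_eq_mul, ← mul_assoc,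
    classPrior, Measure.real, mul_inv_cancel₀, one_mul]
  exact hy.ne'

/-- The law of total expectation over the label. -/
lemma integral_eq_sum_classLaw [IsProbabilityMeasure P] (hpos : 0 < classPrior P 1)
    (hneg : 0 < classPrior P (-1)) {h : X → ℤˣ → ℝ} {a b : ℝ} (hm : ∀ y, Measurable fun x => h x y)
    (hab : ∀ x y, h x y ∈ Set.Icc a b) :
    ∫ z, h z.1 z.2 ∂P = classPrior P (-1) * ∫ x, h x (-1) ∂(classLaw P (-1)) +
      classPrior P 1 * ∫ x, h x 1 ∂(classLaw P 1) := by
  have hset : ∀ y, Set.EqOn (fun z : X × ℤˣ => h z.1 z.2) (fun z => h z.1 y) {z | z.2 = y} :=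
    fun y z hz => congrArg (h z.1) hz
  have hi : ∀ y, IntegrableOn (fun z : X × ℤˣ => h z.1 z.2) {z | z.2 = y} P := fun y =>
    IntegrableOn.congr_fun (f := fun z : X × ℤˣ => h z.1 y)
      (Integrable.of_mem_Icc a b ((hm y).comp measurable_fst).aemeasurable
        (ae_of_all _ fun z => hab _ _)) (hset y).symm (measurableSet_label y)
  have hcompl : {z : X × ℤˣ | z.2 = -1}ᶜ = {z | z.2 = 1} := by
    ext z
    rcases Int.units_eq_one_or z.2 with h | h <;> simp [h]
  have hint : Integrable (fun z : X × ℤˣ => h z.1 z.2) P := by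
    rw [← integrableOn_univ, ← Set.union_compl_self {z : X × ℤˣ | z.2 = -1}, hcompl]
    exact (hi _).union (hi _)
  rw [← integral_add_compl (measurableSet_label (-1)) hint, hcompl,
    setIntegral_congr_fun (measurableSet_label (-1)) (hset (-1)),
    setIntegral_congr_fun (measurableSet_label 1) (hset 1),
    setIntegral_label hneg (hm _), setIntegral_label hpos (hm _)]

lemma risk_eq [IsProbabilityMeasure P] (hpos : 0 < classPrior P 1)
    (hneg : 0 < classPrior P (-1)) {ℓ : ℝ → ℤˣ → ℝ} {C : ℝ} (hcont : ∀ y, Continuous fun t => ℓ t y)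
    (hℓ : ∀ t y, ℓ t y ∈ Set.Icc 0 C) {g : X → ℝ} (hg : Measurable g) :
    risk ℓ P g = classPrior P (-1) * lawRisk ℓ (classLaw P (-1)) (-1) g +
      classPrior P 1 * lawRisk ℓ (classLaw P 1) 1 g :=
  integral_eq_sum_classLaw hpos hneg (h := fun x y => ℓ (g x) y)
    (fun y => (hcont y).measurable.comp hg) fun _ _ => hℓ _ _

lemma lawRisk_unlabeledLaw_eq [IsProbabilityMeasure P] (hpos : 0 < classPrior P 1)
    (hneg : 0 < classPrior P (-1)) {ℓ : ℝ → ℤˣ → ℝ} {C : ℝ} {y : ℤˣ}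
    (hcont : Continuous fun t => ℓ t y)
    (hℓ : ∀ t, ℓ t y ∈ Set.Icc 0 C) {g : X → ℝ} (hg : Measurable g) :
    lawRisk ℓ (unlabeledLaw P) y g = classPrior P (-1) * lawRisk ℓ (classLaw P (-1)) y g +
      classPrior P 1 * lawRisk ℓ (classLaw P 1) y g := by
  have hm : Measurable fun x => ℓ (g x) y := hcont.measurable.comp hg
  rw [lawRisk, unlabeledLaw, integral_map measurable_fst.aemeasurable hm.aestronglyMeasurable]
  exact integral_eq_sum_classLaw hpos hneg (h := fun x _ => ℓ (g x) y) (fun _ => hm)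
    fun _ _ => hℓ _

end

/-! ### Uniform deviation of the nonnegative risk estimator -/

section

variable {X : Type*} [MeasurableSpace X]

/-- The combination of ghost deviations that bounds the error of the nonnegative risk estimator,
uniformly over `G`. -/
noncomputable def totalDeviation (ℓ : ℝ → ℤˣ → ℝ) (P : Measure (X × ℤˣ)) (a : ℝ)
    (G : Set (X → ℝ)) {np nn nu : ℕ} (S : Data X np nn nu) : ℝ :=
  classPrior P (-1) * ghostDeviation ℓ (-1) (classLaw P (-1)) G S.2.1
    + (1 - a) * classPrior P 1 * ghostDeviation ℓ 1 (classLaw P 1) G S.1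
    + a * (ghostDeviation ℓ 1 (unlabeledLaw P) G S.2.2
      + classPrior P (-1) * ghostDeviation ℓ 1 (classLaw P (-1)) G S.2.1)

/-- The mean of `totalDeviation`, term by term. -/
noncomputable def meanDeviation (ℓ : ℝ → ℤˣ → ℝ) (P : Measure (X × ℤˣ)) (a : ℝ)
    (G : Set (X → ℝ)) (np nn nu : ℕ) : ℝ :=
  classPrior P (-1) * (∫ S, ghostDeviation ℓ (-1) (classLaw P (-1)) G S
      ∂(Measure.pi fun _ : Fin nn => classLaw P (-1)))
    + (1 - a) * classPrior P 1 * (∫ S, ghostDeviation ℓ 1 (classLaw P 1) G S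
      ∂(Measure.pi fun _ : Fin np => classLaw P 1))
    + a * ((∫ S, ghostDeviation ℓ 1 (unlabeledLaw P) G S
      ∂(Measure.pi fun _ : Fin nu => unlabeledLaw P))
      + classPrior P (-1) * (∫ S, ghostDeviation ℓ 1 (classLaw P (-1)) G S
      ∂(Measure.pi fun _ : Fin nn => classLaw P (-1))))

variable {P : Measure (X × ℤˣ)} [IsProbabilityMeasure P] {np nn nu : ℕ} {a : ℝ}
  {G : Set (X → ℝ)} {Cg : ℝ} {ℓ : ℝ → ℤˣ → ℝ} {C L : ℝ≥0}

/-- The term `R_u^+ - π_n R_n^+ = π_p R_p^+` of the risk is nonnegative, hence equal to its positive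
part, and passing to positive parts is a contraction: so the truncation in the estimator costs
nothing. -/
lemma abs_risk_sub_nonnegRisk_le (hpos : 0 < classPrior P 1) (hneg : 0 < classPrior P (-1))
    (hnp : 0 < np) (hnn : 0 < nn) (hnu : 0 < nu) (ha0 : 0 < a) (ha1 : a < 1)
    (hG : SupMeasurable G) (hcont : ∀ y, Continuous fun t => ℓ t y)
    (hℓ : ∀ t y, ℓ t y ∈ Set.Icc 0 (C : ℝ)) {g : X → ℝ} (hgG : g ∈ G) (hg : Measurable g)
    (S : Data X np nn nu) :
    |risk ℓ P g - nonnegRisk ℓ P a S g| ≤ totalDeviation ℓ P a G S := by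
  have := isProbabilityMeasure_classLaw hpos
  have := isProbabilityMeasure_classLaw hneg
  have hp := abs_lawRisk_sub_empRisk_le (q := classLaw P 1) hnp hG hgG hg (hcont 1)
    (fun t => hℓ t 1) S.1
  have hn := abs_lawRisk_sub_empRisk_le (q := classLaw P (-1)) hnn hG hgG hg (hcont (-1))
    (fun t => hℓ t (-1)) S.2.1
  have hn' := abs_lawRisk_sub_empRisk_le (q := classLaw P (-1)) hnn hG hgG hg (hcont 1)
    (fun t => hℓ t 1) S.2.1
  have hu := abs_lawRisk_sub_empRisk_le (q := unlabeledLaw P) hnu hG hgG hg (hcont 1)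
    (fun t => hℓ t 1) S.2.2
  have hW := lawRisk_unlabeledLaw_eq hpos hneg (hcont 1) (fun t => hℓ t 1) hg
  have hRp : 0 ≤ classPrior P 1 * lawRisk ℓ (classLaw P 1) 1 g :=
    mul_nonneg hpos.le (integral_nonneg fun x => (hℓ _ _).1)
  rw [risk_eq hpos hneg hcont hℓ hg, nonnegRisk, totalDeviation]
  set wu := empRisk ℓ 1 S.2.2 g
  set wn' := empRisk ℓ 1 S.2.1 g
  set wn := empRisk ℓ (-1) S.2.1 g
  set wp := empRisk ℓ 1 S.1 g
  set rp := lawRisk ℓ (classLaw P 1) 1 g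
  set rn := lawRisk ℓ (classLaw P (-1)) (-1) g
  set rn' := lawRisk ℓ (classLaw P (-1)) 1 g
  set ru := lawRisk ℓ (unlabeledLaw P) 1 g
  set πp := classPrior P 1
  set πn := classPrior P (-1)
  have hpart : |πp * rp - max 0 (wu - πn * wn')| ≤ |ru - wu| + πn * |rn' - wn'| := by
    have h1 := abs_max_sub_max_le_abs (πp * rp) (wu - πn * wn') 0
    rw [max_eq_left hRp, max_comm (wu - πn * wn')] at h1
    have h2 : πp * rp - (wu - πn * wn') = (ru - wu) - πn * (rn' - wn') := by rw [hW]; ring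
    rw [h2] at h1
    refine h1.trans ((abs_sub _ _).trans_eq ?_)
    rw [abs_mul, abs_of_pos hneg]
  have hsplit : πn * rn + πp * rp - (πn * wn + (1 - a) * πp * wp + a * max 0 (wu - πn * wn')) =
      πn * (rn - wn) + (1 - a) * πp * (rp - wp) + a * (πp * rp - max 0 (wu - πn * wn')) := by
    ring
  have ha : 0 ≤ 1 - a := by linarith
  rw [hsplit]
  refine (abs_add_three _ _ _).trans ?_
  rw [abs_mul πn, abs_mul ((1 - a) * πp), abs_mul a, abs_of_pos hneg, abs_of_pos ha0,
    abs_of_nonneg (mul_nonneg ha hpos.le)]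
  have := hpos.le
  have := hneg.le
  gcongr
  exact hpart.trans (by gcongr)

lemma meanDeviation_le (hpos : 0 < classPrior P 1) (hneg : 0 < classPrior P (-1))
    (ha0 : 0 < a) (ha1 : a < 1) (hGne : G.Nonempty) (hG : SupMeasurable G)
    (hGbdd : ∀ g ∈ G, ∀ x, |g x| ≤ Cg) (hGneg : ∀ g ∈ G, -g ∈ G)
    (hLip : ∀ y, LipschitzWith L fun t => ℓ t y) (hℓ : ∀ t y, ℓ t y ∈ Set.Icc 0 (C : ℝ)) :
    meanDeviation ℓ P a G np nn nu ≤
      4 * (1 + a) * classPrior P (-1) * L * rademacher nn (classLaw P (-1)) G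
        + 4 * (1 - a) * classPrior P 1 * L * rademacher np (classLaw P 1) G
        + 4 * a * L * rademacher nu (unlabeledLaw P) G := by
  have := isProbabilityMeasure_classLaw hpos
  have := isProbabilityMeasure_classLaw hneg
  have h : ∀ (q : Measure X) [IsProbabilityMeasure q] (n : ℕ) (y : ℤˣ),
      ∫ S, ghostDeviation ℓ y q G S ∂(Measure.pi fun _ : Fin n => q) ≤
        4 * L * rademacher n q G := fun q _ n y =>
    integral_ghostDeviation_le hGne hG hGbdd hGneg (hLip y) fun t => hℓ t y
  have ha : 0 ≤ 1 - a := by linarith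
  have := hpos.le
  have := hneg.le
  calc meanDeviation ℓ P a G np nn nu
      ≤ classPrior P (-1) * (4 * L * rademacher nn (classLaw P (-1)) G)
        + (1 - a) * classPrior P 1 * (4 * L * rademacher np (classLaw P 1) G)
        + a * (4 * L * rademacher nu (unlabeledLaw P) G
          + classPrior P (-1) * (4 * L * rademacher nn (classLaw P (-1)) G)) := by
        unfold meanDeviation
        gcongr <;> apply h
    _ = _ := by ring

lemma isProbabilityMeasure_dataLaw (hpos : 0 < classPrior P 1) (hneg : 0 < classPrior P (-1)) :
    IsProbabilityMeasure (dataLaw P np nn nu) := by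
  have := isProbabilityMeasure_classLaw hpos
  have := isProbabilityMeasure_classLaw hneg
  unfold dataLaw
  infer_instance

/-- The standard deviations of the terms add up, whether or not the terms are independent. -/
lemma hasSubgaussianMGF_totalDeviation (hpos : 0 < classPrior P 1) (hneg : 0 < classPrior P (-1))
    (hnp : 0 < np) (hnn : 0 < nn) (hnu : 0 < nu) (ha0 : 0 < a) (ha1 : a < 1)
    (hGne : G.Nonempty) (hG : SupMeasurable G) (hcont : ∀ y, Continuous fun t => ℓ t y)
    (hℓ : ∀ t y, ℓ t y ∈ Set.Icc 0 (C : ℝ)) {s : ℝ≥0}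
    (hs : (s : ℝ) = C / 2 * ((1 + a) * classPrior P (-1) / √nn + (1 - a) * classPrior P 1 / √np
      + a / √nu)) :
    HasSubgaussianMGF (fun S => totalDeviation ℓ P a G S - meanDeviation ℓ P a G np nn nu) (s ^ 2)
      (dataLaw P np nn nu) := by
  have := isProbabilityMeasure_classLaw hpos
  have := isProbabilityMeasure_classLaw hneg
  have h : ∀ (q : Measure X) [IsProbabilityMeasure q] {n : ℕ} (_ : 0 < n) (y : ℤˣ)
      {e : Data X np nn nu → Fin n → X}
      (_ : MeasurePreserving e (dataLaw P np nn nu) (Measure.pi fun _ : Fin n => q)),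
      HasSubgaussianMGF (fun S => ghostDeviation ℓ y q G (e S) -
        ∫ S, ghostDeviation ℓ y q G S ∂(Measure.pi fun _ : Fin n => q))
        ((C / (2 * NNReal.sqrt n)) ^ 2) (dataLaw P np nn nu) := by
    intro q _ n hn y e he
    have h1 := hasSubgaussianMGF_ghostDeviation (q := q) (n := n) hGne hG (hcont y)
      fun t => hℓ t y
    rw [← he.map_eq] at h1
    have h2 := h1.of_map he.aemeasurable
    rw [he.map_eq] at h2
    have h3 : (n * (C / n / 2) ^ 2 : ℝ≥0) = (C / (2 * NNReal.sqrt n)) ^ 2 := by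
      have : (n : ℝ≥0) ≠ 0 := by exact_mod_cast hn.ne'
      rw [div_pow C (2 * _), mul_pow, NNReal.sq_sqrt]
      field_simp
    rw [h3] at h2
    exact h2
  have mp1 : MeasurePreserving (fun S : Data X np nn nu => S.1) (dataLaw P np nn nu)
      (Measure.pi fun _ => classLaw P 1) := measurePreserving_fst
  have mp2 : MeasurePreserving (fun S : Data X np nn nu => S.2.1) (dataLaw P np nn nu)
      (Measure.pi fun _ => classLaw P (-1)) := measurePreserving_fst.comp measurePreserving_snd
  have mp3 : MeasurePreserving (fun S : Data X np nn nu => S.2.2) (dataLaw P np nn nu)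
      (Measure.pi fun _ => unlabeledLaw P) := measurePreserving_snd.comp measurePreserving_snd
  have k1 := h (classLaw P 1) hnp 1 mp1
  have k2 := h (classLaw P (-1)) hnn (-1) mp2
  have k2' := h (classLaw P (-1)) hnn 1 mp2
  have k3 := h (unlabeledLaw P) hnu 1 mp3
  obtain ⟨πn, hπn⟩ : ∃ r : ℝ≥0, (r : ℝ) = classPrior P (-1) := ⟨⟨_, hneg.le⟩, rfl⟩
  obtain ⟨πp, hπp⟩ : ∃ r : ℝ≥0, (r : ℝ) = classPrior P 1 := ⟨⟨_, hpos.le⟩, rfl⟩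
  obtain ⟨α, hα⟩ : ∃ r : ℝ≥0, (r : ℝ) = a := ⟨⟨_, ha0.le⟩, rfl⟩
  obtain ⟨β, hβ⟩ : ∃ r : ℝ≥0, (r : ℝ) = 1 - a := ⟨⟨1 - a, by linarith⟩, rfl⟩
  have key := hasSubgaussianMGF_add_sq (hasSubgaussianMGF_add_sq
    (hasSubgaussianMGF_const_mul_sq k2 πn) (hasSubgaussianMGF_const_mul_sq k1 (β * πp)))
    (hasSubgaussianMGF_const_mul_sq
      (hasSubgaussianMGF_add_sq k3 (hasSubgaussianMGF_const_mul_sq k2' πn)) α)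
  have hs' : πn * (C / (2 * NNReal.sqrt nn)) + β * πp * (C / (2 * NNReal.sqrt np)) +
      α * (C / (2 * NNReal.sqrt nu) + πn * (C / (2 * NNReal.sqrt nn))) = s := by
    apply NNReal.coe_injective
    rw [hs]
    push_cast
    rw [hπn, hπp, hα, hβ]
    ring
  rw [hs'] at key
  refine key.congr (ae_of_all _ fun S => ?_)
  simp only [NNReal.coe_mul, hπn, hπp, hα, hβ, totalDeviation, meanDeviation]
  ring

/-- The uniform deviation bound, for a loss that is bounded and Lipschitz on all of `ℝ`. -/
theorem exists_measurableSet_totalDeviation_le (hpos : 0 < classPrior P 1)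
    (hneg : 0 < classPrior P (-1))
    (hnp : 0 < np) (hnn : 0 < nn) (hnu : 0 < nu) (ha0 : 0 < a) (ha1 : a < 1)
    (hGne : G.Nonempty) (hG : SupMeasurable G) (hGbdd : ∀ g ∈ G, ∀ x, |g x| ≤ Cg)
    (hGneg : ∀ g ∈ G, -g ∈ G) (hLip : ∀ y, LipschitzWith L fun t => ℓ t y) (hC : 0 < C)
    (hℓ : ∀ t y, ℓ t y ∈ Set.Icc 0 (C : ℝ)) {δ : ℝ} (hδ : 0 < δ) :
    ∃ E : Set (Data X np nn nu), MeasurableSet E ∧ 1 - δ ≤ (dataLaw P np nn nu).real E ∧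
      ∀ S ∈ E, totalDeviation ℓ P a G S ≤
        4 * (1 + a) * classPrior P (-1) * L * rademacher nn (classLaw P (-1)) G
        + 4 * (1 - a) * classPrior P 1 * L * rademacher np (classLaw P 1) G
        + 4 * a * L * rademacher nu (unlabeledLaw P) G
        + C * √(Real.log (2 / δ) / 2) *
          ((1 + a) * classPrior P (-1) / √nn + (1 - a) * classPrior P 1 / √np + a / √nu) := by
  -- For `1 ≤ δ` the empty event will do; `δ < 1` makes `log (2 / δ)` positive.
  rcases le_or_gt 1 δ with hδ1 | hδ1
  · exact ⟨∅, MeasurableSet.empty, by simpa using hδ1, by simp⟩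
  have := isProbabilityMeasure_dataLaw (np := np) (nn := nn) (nu := nu) hpos hneg
  set B := (1 + a) * classPrior P (-1) / √nn + (1 - a) * classPrior P 1 / √np + a / √nu
  have hB0 : 0 < B := by
    have h1 : 0 < 1 - a := by linarith
    have h2 : (0 : ℝ) < np := by exact_mod_cast hnp
    have h3 : (0 : ℝ) < nn := by exact_mod_cast hnn
    have h4 : (0 : ℝ) < nu := by exact_mod_cast hnu
    positivity
  have hC' : (0 : ℝ) < C := by exact_mod_cast hC
  obtain ⟨s, hs⟩ : ∃ s : ℝ≥0, (s : ℝ) = C / 2 * B := ⟨⟨_, by positivity⟩, rfl⟩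
  have hsub := hasSubgaussianMGF_totalDeviation hpos hneg hnp hnn hnu ha0 ha1 hGne hG
    (fun y => (hLip y).continuous) hℓ hs
  set m := meanDeviation ℓ P a G np nn nu
  have hm : m ≤ _ := meanDeviation_le hpos hneg ha0 ha1 hGne hG hGbdd hGneg hLip hℓ
  set Λ := Real.log (2 / δ) / 2 with hΛ
  have hΛ0 : 0 ≤ Λ := div_nonneg (Real.log_nonneg (by rw [le_div_iff₀ hδ]; linarith)) zero_le_two
  have htail := hsub.measure_ge_le (ε := C * √Λ * B) (by positivity)
  -- The threshold is `2 √Λ` standard deviations, so the tail bound is `exp (-2 Λ) = δ / 2`.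
  have hexp : Real.exp (-(C * √Λ * B) ^ 2 / (2 * ((s ^ 2 : ℝ≥0) : ℝ))) = δ / 2 := by
    have h1 : -(C * √Λ * B) ^ 2 / (2 * ((s ^ 2 : ℝ≥0) : ℝ)) = -Real.log (2 / δ) := by
      rw [NNReal.coe_pow, hs, mul_pow, mul_pow, Real.sq_sqrt hΛ0, hΛ]
      field_simp
    rw [h1, Real.exp_neg, Real.exp_log (by positivity), inv_div]
  rw [hexp] at htail
  set A := {S : Data X np nn nu | C * √Λ * B ≤ totalDeviation ℓ P a G S - m}
  have hA : NullMeasurableSet A (dataLaw P np nn nu) :=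
    nullMeasurableSet_le aemeasurable_const hsub.aemeasurable
  obtain ⟨E, hEA, hE, hEae⟩ := hA.compl.exists_measurable_subset_ae_eq
  refine ⟨E, hE, ?_, fun S hS => ?_⟩
  · rw [measureReal_congr hEae, probReal_compl_eq_one_sub₀ hA]
    linarith
  · have : totalDeviation ℓ P a G S - m < C * √Λ * B := not_le.1 (hEA hS)
    linarith

end

/-! ### Reduction to a globally bounded and Lipschitz loss -/

/-- The loss composed with the projection of `ℝ` to `[-c, c]`. It agrees with `ℓ` on the values of
functions bounded by `c`, and is bounded and Lipschitz on all of `ℝ` as soon as `ℓ` is so on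
`[-c, c]`. -/
def clampLoss (ℓ : ℝ → ℤˣ → ℝ) (c : ℝ) (t : ℝ) (y : ℤˣ) : ℝ :=
  ℓ (max (-c) (min c t)) y

variable {ℓ : ℝ → ℤˣ → ℝ} {c : ℝ}

lemma abs_clamp_le (hc : 0 ≤ c) (t : ℝ) : |max (-c) (min c t)| ≤ c :=
  abs_le.2 ⟨le_max_left _ _, max_le (by linarith) (min_le_left _ _)⟩

lemma clampLoss_eq {t : ℝ} (ht : |t| ≤ c) (y : ℤˣ) : clampLoss ℓ c t y = ℓ t y := by
  obtain ⟨h1, h2⟩ := abs_le.1 ht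
  rw [clampLoss, min_eq_right h2, max_eq_right h1]

lemma lipschitzWith_clampLoss (hc : 0 ≤ c) {L : ℝ≥0} {y : ℤˣ}
    (h : LipschitzOnWith L (fun t => ℓ t y) {t | |t| ≤ c}) :
    LipschitzWith L fun t => clampLoss ℓ c t y := by
  have hclamp : LipschitzWith 1 fun t : ℝ => max (-c) (min c t) :=
    (LipschitzWith.id.const_min c).const_max (-c)
  have := lipschitzOnWith_univ.1 (h.comp (lipschitzOnWith_univ.2 hclamp)
    fun t _ => abs_clamp_le hc t)
  rwa [mul_one] at this

section

variable {X : Type*} {g : X → ℝ}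

lemma risk_clampLoss [MeasurableSpace X] (P : Measure (X × ℤˣ)) (hg : ∀ x, |g x| ≤ c) :
    risk (clampLoss ℓ c) P g = risk ℓ P g := by
  simp only [risk, clampLoss_eq (hg _)]

lemma nonnegRisk_clampLoss [MeasurableSpace X] (P : Measure (X × ℤˣ)) (a : ℝ) {np nn nu : ℕ}
    (S : Data X np nn nu) (hg : ∀ x, |g x| ≤ c) :
    nonnegRisk (clampLoss ℓ c) P a S g = nonnegRisk ℓ P a S g := by
  simp only [nonnegRisk, empRisk, clampLoss_eq (hg _)]

end

end AnomalyRisk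

theorem theorem2 {X : Type*} [MeasurableSpace X]
    -- the joint law of `(x, y)`, both classes having positive probability
    (P : Measure (X × ℤˣ)) [IsProbabilityMeasure P]
    (hpos : 0 < classPrior P 1) (hneg : 0 < classPrior P (-1))
    -- sample sizes and the weight of the convex combination
    (np nn nu : ℕ) (hnp : 0 < np) (hnn : 0 < nn) (hnu : 0 < nu)
    (a : ℝ) (ha0 : 0 < a) (ha1 : a < 1)
    -- the function class and the loss
    (G : Set (X → ℝ)) (Cg : ℝ)
    (hGmeas : ∀ g ∈ G, Measurable g) (hGsup : SupMeasurable G)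
    (hGbdd : ∀ g ∈ G, ∀ x, |g x| ≤ Cg)
    (hGneg : ∀ g ∈ G, -g ∈ G)
    (ℓ : ℝ → ℤˣ → ℝ) (Cℓ : ℝ) (hCℓ : 0 < Cℓ)
    (hℓ : ∀ t, |t| ≤ Cg → ∀ y, 0 ≤ ℓ t y ∧ ℓ t y ≤ Cℓ)
    (Lℓ : ℝ≥0) (hLip : ∀ y, LipschitzOnWith Lℓ (fun t => ℓ t y) {t | |t| ≤ Cg})
    (ρ : ℝ) (hρ : 0 < ρ) (hR : ∀ g ∈ G, ρ ≤ lawRisk ℓ (classLaw P 1) 1 g)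
    -- the true risk minimizer
    (gstar : X → ℝ) (hgstar : gstar ∈ G) (hgstar_min : IsMinOn (risk ℓ P) G gstar)
    (δ : ℝ) (hδ : 0 < δ) :
    -- with probability at least `1 - δ`, every empirical risk minimizer satisfies the bound
    ∃ E : Set (Data X np nn nu), MeasurableSet E ∧ 1 - δ ≤ (dataLaw P np nn nu).real E ∧
      ∀ S ∈ E, ∀ ghat ∈ G, IsMinOn (nonnegRisk ℓ P a S) G ghat →
        risk ℓ P ghat - risk ℓ P gstar ≤
          8 * (1 + a) * classPrior P (-1) * Lℓ * rademacher nn (classLaw P (-1)) G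
          + 8 * (1 - a) * classPrior P 1 * Lℓ * rademacher np (classLaw P 1) G
          + 8 * a * Lℓ * rademacher nu (unlabeledLaw P) G
          + 2 * Cℓ * √(Real.log (2 / δ) / 2) *
              ((1 + a) * classPrior P (-1) / √nn + (1 - a) * classPrior P 1 / √np + a / √nu)
          + 2 * biasTerm P a Cℓ ρ nn nu := by
  have hX : Nonempty X := (nonempty_of_isProbabilityMeasure P).map Prod.fst
  have hCg : 0 ≤ Cg := (abs_nonneg _).trans (hGbdd gstar hgstar hX.some)
  lift Cℓ to ℝ≥0 using hCℓ.le
  set ℓ' := clampLoss ℓ Cg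
  have hLip' : ∀ y, LipschitzWith Lℓ fun t => ℓ' t y := fun y =>
    lipschitzWith_clampLoss hCg (hLip y)
  have hℓ' : ∀ t y, ℓ' t y ∈ Set.Icc 0 (Cℓ : ℝ) := fun t y => hℓ _ (abs_clamp_le hCg t) y
  obtain ⟨E, hE, hPE, hbound⟩ := exists_measurableSet_totalDeviation_le
    hpos hneg hnp hnn hnu ha0 ha1 ⟨gstar, hgstar⟩ hGsup hGbdd hGneg hLip'
    (NNReal.coe_pos.1 hCℓ) hℓ' hδ
  refine ⟨E, hE, hPE, fun S hS ghat hghat hmin => ?_⟩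
  have hdev : ∀ g ∈ G, |risk ℓ P g - nonnegRisk ℓ P a S g| ≤ totalDeviation ℓ' P a G S :=
    fun g hg => by
      rw [← risk_clampLoss P (hGbdd g hg), ← nonnegRisk_clampLoss P a S (hGbdd g hg)]
      exact abs_risk_sub_nonnegRisk_le hpos hneg hnp hnn hnu ha0 ha1 hGsup
        (fun y => (hLip' y).continuous) hℓ' hg (hGmeas g hg) S
  have h1 := (abs_le.1 (hdev ghat hghat)).2
  have h2 := (abs_le.1 (hdev gstar hgstar)).1
  have h3 : nonnegRisk ℓ P a S ghat ≤ nonnegRisk ℓ P a S gstar := hmin hgstar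
  have h4 := hbound S hS
  have h5 : 0 ≤ biasTerm P a Cℓ ρ nn nu := by
    unfold biasTerm
    positivity
  linarith
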